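/- For a finite simple graph $\mathcal{G}$ with vertex set $V(\mathcal{G})$ let $CN(\mathcal{G})$ be the matrix indexed by $V(\mathcal{G})$ whose $(v,w)$ entry is the number of common neighbours of $v$ and $w$ if $v\neq w$, and $0$ if $v=w$. Let $CNRS(\mathcal{G})$ be the diagonal matrix of the row sums of $CN(\mathcal{G})$, and put $CNL(\mathcal{G})=CNRS(\mathcal{G})-CN(\mathcal{G})$ and $CNSL(\mathcal{G})=CNRS(\mathcal{G})+CN(\mathcal{G})$. The CNL-spectrum and the CNSL-spectrum of $\mathcal{G}$ are the multisets of eigenvalues, with multiplicities, of $CNL(\mathcal{G})$ and $CNSL(\mathcal{G})$. With $\Delta_{\mathcal{G}}=\operatorname{tr}(CNRS(\mathcal{G}))/|V(\mathcal{G})|$, the CNL-energy is $LE_{CN}(\mathcal{G})=\sum_{\alpha}|\alpha-\Delta_{\mathcal{G}}|$, the sum over the CNL-spectrum with multiplicities, and the CNSL-energy is $LE^+_{CN}(\mathcal{G})=\sum_{\beta}|\beta-\Delta_{\mathcal{G}}|$, the sum over the CNSL-spectrum with multiplicities. The commuting graph $\Gamma_G$ of a finite group $G$ has vertex set $G\setminus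 Z(G)$, two distinct vertices being adjacent if and only if they commute. Write $lK_m$ for the disjoint union of $l$ copies of the complete graph on $m$ vertices, and $a^{(n)}$ for $a$ repeated $n$ times in a multiset (repetitions of equal values add up). **Proposition.** Let $k\geq 2$ and let $\Gamma$ be the commuting graph of $PSL(2,2^k)$, the projective special linear group of degree $2$ over the field with $2^k$ elements. Then: 1. $\Gamma\cong(2^k+1)K_{2^k-1}\sqcup 2^{k-1}(2^k+1)K_{2^k-2}\sqcup 2^{k-1}(2^k-1)K_{2^k}$. 2. The CNL-spectrum of $\Gamma$ is $$\bigl\{0^{(2^k+2^{2k}+1)},\ ((2^k-1)(2^k-3))^{((2^k+1)(2^k-2))},\ ((2^k-2)(2^k-4))^{(2^{k-1}(2^k+1)(2^k-3))},\ (2^k(2^k-2))^{(2^{k-1}(2^k-1)^2)}\bigr\}.$$ 3. The CNSL-spectrum of $\Gamma$ is $$\bigl\{(2(2^k-2)(2^k-3))^{(2^k+1)},\ ((2^k-3)^2)^{((2^k+1)(2^k-2))},\ (2(2^k-3)(2^k-4))^{(2^{k-1}(2^k+1))},$$ $$((2^k-4)^2)^{(2^{k-1}(2^k+1)(2^k-3))},\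 (2(2^k-1)(2^k-2))^{(2^{k-1}(2^k-1))},\ ((2^k-2)^2)^{(2^{k-1}(2^k-1)^2)}\bigr\}.$$ 4. $$LE_{CN}(\Gamma)=\frac{(2^k-2)\left(19\cdot 2^k-2^{3k+2}+3\cdot 4^{k+1}-7\cdot 16^k-5\cdot 32^k+3\cdot 64^k+6\right)}{8^k-2^k-1}.$$ 5. $LE^+_{CN}(\Gamma)=\dfrac{9260}{59}$ if $k=2$, and for $k\geq 3$ $$LE^+_{CN}(\Gamma)=\frac{-5\cdot 2^{k+2}+7\cdot 2^{3k+1}+2^{4k+5}-9\cdot 4^k+32^k-13\cdot 64^k+3\cdot 128^k-12}{8^k-2^k-1}.$$ -/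

import Mathlib

namespace CommonNeighbourhood

/-- The non-central elements of a group `G`, i.e. `G \ Z(G)`. -/
abbrev NonCentral (G : Type*) [Group G] : Type _ :=
  {g : G // g ∉ Subgroup.center G}

noncomputable instance instFintypeNonCentral (G : Type*) [Group G] [Finite G] :
    Fintype (NonCentral G) :=
  Fintype.ofFinite _

/-- The commuting graph of a group `G`: the vertices are the non-central elements, and two
distinct vertices are adjacent if they commute in `G`. -/
def commutingGraph (G : Type*) [Group G] : SimpleGraph (NonCentral G) where
  Adj x y := x ≠ y ∧ (x : G) * (y : G) = (y : G) * (x : G)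
  symm := ⟨fun _ _ h => ⟨h.1.symm, h.2.symm⟩⟩
  loopless := ⟨fun _ h => h.1 rfl⟩

/-- `copiesOfComplete l m` is `l K_m`, the disjoint union of `l` copies of the complete graph on
`m` vertices; the vertex `(c, i)` is the vertex `i` of the copy `c`. -/
def copiesOfComplete (l m : ℕ) : SimpleGraph (Fin l × Fin m) where
  Adj x y := x.1 = y.1 ∧ x.2 ≠ y.2
  symm := ⟨fun _ _ h => ⟨h.1.symm, h.2.symm⟩⟩
  loopless := ⟨fun _ h => h.2 rfl⟩

variable {V : Type*}

open scoped Classical in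
/-- The common neighbourhood matrix `CN(Γ)`: the entry at `(v, w)` is the number of common
neighbours of `v` and `w` if `v ≠ w`, and `0` if `v = w`. -/
noncomputable def cnMatrix (Γ : SimpleGraph V) : Matrix V V ℝ :=
  Matrix.of fun v w => if v = w then 0 else ((Γ.commonNeighbors v w).ncard : ℝ)

open scoped Classical in
/-- The diagonal matrix `CNRS(Γ)` of the row sums of `CN(Γ)`. -/
noncomputable def cnrsMatrix [Fintype V] (Γ : SimpleGraph V) : Matrix V V ℝ :=
  Matrix.diagonal fun v => ∑ w, cnMatrix Γ v w

/-- The common neighbourhood Laplacian matrix `CNL(Γ) = CNRS(Γ) - CN(Γ)`. -/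
noncomputable def cnlMatrix [Fintype V] (Γ : SimpleGraph V) : Matrix V V ℝ :=
  cnrsMatrix Γ - cnMatrix Γ

/-- The common neighbourhood signless Laplacian matrix `CNSL(Γ) = CNRS(Γ) + CN(Γ)`. -/
noncomputable def cnslMatrix [Fintype V] (Γ : SimpleGraph V) : Matrix V V ℝ :=
  cnrsMatrix Γ + cnMatrix Γ

open scoped Classical in
/-- The CNL-spectrum: the multiset of eigenvalues of the real symmetric matrix `CNL(Γ)`, as roots
of its characteristic polynomial, with multiplicities. -/
noncomputable def cnlSpec [Fintype V] (Γ : SimpleGraph V) : Multiset ℝ :=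
  (cnlMatrix Γ).charpoly.roots

open scoped Classical in
/-- The CNSL-spectrum: the multiset of eigenvalues of the real symmetric matrix `CNSL(Γ)`, as
roots of its characteristic polynomial, with multiplicities. -/
noncomputable def cnslSpec [Fintype V] (Γ : SimpleGraph V) : Multiset ℝ :=
  (cnslMatrix Γ).charpoly.roots

/-- `Δ_Γ = tr(CNRS(Γ)) / |V(Γ)|`. -/
noncomputable def cnDelta [Fintype V] (Γ : SimpleGraph V) : ℝ :=
  (cnrsMatrix Γ).trace / (Fintype.card V : ℝ)

/-- The CNL-energy: the sum of `|α - Δ_Γ|` over the CNL-spectrum, with multiplicities. -/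
noncomputable def cnlEnergy [Fintype V] (Γ : SimpleGraph V) : ℝ :=
  ((cnlSpec Γ).map fun a => |a - cnDelta Γ|).sum

/-- The CNSL-energy: the sum of `|β - Δ_Γ|` over the CNSL-spectrum, with multiplicities. -/
noncomputable def cnslEnergy [Fintype V] (Γ : SimpleGraph V) : ℝ :=
  ((cnslSpec Γ).map fun b => |b - cnDelta Γ|).sum

end CommonNeighbourhood

/-! Let `q = |F|` be even. A scalar `r` of determinant one satisfies `r ^ 2 = 1`, hence `r = 1`, so
`SL(2, F)` has trivial center and is `PSL(2, F)`. Two matrices commute exactly when their triples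
`(a - d, b, c)` are proportional (`specialLinearGroup_two_commute_iff`), so commuting is an
equivalence relation on the non-central elements, with one class for each point of the projective
plane, and the graph is a disjoint union of cliques.

The matrices over a point are `y (t + N)`. Square roots exist and are unique in `F`, so each `t`
with `det (t + N) ≠ 0` gives exactly one element of determinant one, and the clique has `q` minus
the number of roots of `det (t + N)` vertices. Trace zero gives one root (`q + 1` points). Otherwise
the equation is `t (t + 1) = b c`, with two roots or none; `two_mul_natCard_root` finds the split by
double counting.

On `K_m`, with `J` the all-ones matrix, CN is `(m - 2)(J - I)` and CNRS is scalar, so both spectra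
are those of a rank-one matrix plus a scalar, and they add over disjoint unions. The energies then
need only the sign of each eigenvalue minus `Δ`. -/

namespace Matrix

/-! ### Characteristic polynomials of block matrices -/

open Polynomial

theorem charpoly_blockDiagonal {R m o : Type*} [CommRing R] [Fintype m] [DecidableEq m]
    [Fintype o] [DecidableEq o] (M : o → Matrix m m R) :
    (blockDiagonal M).charpoly = ∏ i, (M i).charpoly := by
  have h : (blockDiagonal M).charmatrix = blockDiagonal fun i => (M i).charmatrix := by
    ext ⟨i, a⟩ ⟨j, b⟩ : 1
    by_cases hab : a = b
    · subst hab
      simp [charmatrix_apply, diagonal_apply]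
    · simp [charmatrix, blockDiagonal_apply, hab]
  simp only [charpoly, h, det_blockDiagonal]

/-- The characteristic polynomial of the matrix with `c - μ` on the diagonal and `c` elsewhere. -/
theorem charpoly_const_sub_scalar {R : Type*} [CommRing R] [Nontrivial R] {n : ℕ} (c μ : R) :
    (vecMulVec (fun _ : Fin (n + 1) => c) 1 - scalar _ μ).charpoly =
      (X - C ((n + 1) * c - μ)) * (X - C (-μ)) ^ n := by
  -- The rank-one matrix has characteristic polynomial `X ^ (n + 1) - (n + 1) c X ^ n`; subtracting
  -- `μ` substitutes `X + μ` for `X`.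
  rw [charpoly_sub_scalar, charpoly_vecMulVec]
  simp [dotProduct, smul_eq_C_mul, pow_succ]
  ring

theorem roots_charpoly_blockDiagonal_const {R : Type*} [CommRing R] [IsDomain R] {l n : ℕ}
    (c μ : R) :
    (blockDiagonal fun _ : Fin l =>
        vecMulVec (fun _ : Fin (n + 1) => c) 1 - scalar _ μ).charpoly.roots =
      Multiset.replicate l ((n + 1) * c - μ) + Multiset.replicate (l * n) (-μ) := by
  rw [charpoly_blockDiagonal, Finset.prod_const, charpoly_const_sub_scalar, mul_pow, ← pow_mul,
    roots_mul, roots_pow, roots_X_sub_C, roots_pow, roots_X_sub_C, Multiset.nsmul_singleton,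
    Multiset.nsmul_singleton, Finset.card_univ, Fintype.card_fin, mul_comm n l]
  exact mul_ne_zero (pow_ne_zero _ (X_sub_C_ne_zero _)) (pow_ne_zero _ (X_sub_C_ne_zero _))

end Matrix

/-! ### Isomorphism invariance of spectra and `Δ` -/

namespace CommonNeighbourhood

open Matrix

theorem cnrsMatrix_apply_self {V : Type*} [Fintype V] (G : SimpleGraph V) (v : V) :
    cnrsMatrix G v v = ∑ w, cnMatrix G v w := by
  classical
  exact diagonal_apply_eq _ v

theorem cnrsMatrix_apply_ne {V : Type*} [Fintype V] (G : SimpleGraph V) {v w : V} (h : v ≠ w) :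
    cnrsMatrix G v w = 0 := by
  classical
  exact diagonal_apply_ne _ h

section Iso

variable {V W : Type*} {G : SimpleGraph V} {H : SimpleGraph W}

theorem cnMatrix_iso (e : G ≃g H) (v w : V) :
    cnMatrix H (e v) (e w) = cnMatrix G v w := by
  have h : H.commonNeighbors (e v) (e w) = e '' G.commonNeighbors v w := by
    ext x
    obtain ⟨y, rfl⟩ := e.surjective x
    rw [e.injective.mem_set_image, SimpleGraph.mem_commonNeighbors,
      SimpleGraph.mem_commonNeighbors, e.map_adj_iff, e.map_adj_iff]
  by_cases hvw : v = w
  · simp [cnMatrix, hvw]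
  · simp [cnMatrix, hvw, e.injective.ne hvw, h, Set.ncard_image_of_injective _ e.injective]

variable [Fintype V] [Fintype W]

theorem cnrsMatrix_iso (e : G ≃g H) (v w : V) :
    cnrsMatrix H (e v) (e w) = cnrsMatrix G v w := by
  by_cases hvw : v = w
  · subst hvw
    rw [cnrsMatrix_apply_self, cnrsMatrix_apply_self, ← e.toEquiv.sum_comp]
    exact Finset.sum_congr rfl fun u _ => cnMatrix_iso e v u
  · rw [cnrsMatrix_apply_ne _ hvw, cnrsMatrix_apply_ne _ (e.injective.ne hvw)]

open scoped Classical in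
theorem cnlSpec_iso (e : G ≃g H) : cnlSpec G = cnlSpec H := by
  have h : cnlMatrix H = reindex e.toEquiv e.toEquiv (cnlMatrix G) := by
    rw [← Equiv.symm_apply_eq]
    ext v w
    simpa [cnlMatrix] using congr_arg₂ (· - ·) (cnrsMatrix_iso e v w) (cnMatrix_iso e v w)
  rw [cnlSpec, cnlSpec, h, charpoly_reindex]

open scoped Classical in
theorem cnslSpec_iso (e : G ≃g H) : cnslSpec G = cnslSpec H := by
  have h : cnslMatrix H = reindex e.toEquiv e.toEquiv (cnslMatrix G) := by
    rw [← Equiv.symm_apply_eq]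
    ext v w
    simpa [cnslMatrix] using congr_arg₂ (· + ·) (cnrsMatrix_iso e v w) (cnMatrix_iso e v w)
  rw [cnslSpec, cnslSpec, h, charpoly_reindex]

theorem cnDelta_iso (e : G ≃g H) : cnDelta G = cnDelta H := by
  have h : (cnrsMatrix H).trace = (cnrsMatrix G).trace := by
    rw [trace, trace, ← e.toEquiv.sum_comp]
    exact Finset.sum_congr rfl fun v _ => cnrsMatrix_iso e v v
  rw [cnDelta, cnDelta, h, Fintype.card_congr e.toEquiv]

end Iso

/-! ### Disjoint unions -/

section Sum

variable {V W : Type*} (G : SimpleGraph V) (H : SimpleGraph W)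

theorem cnMatrix_sum :
    cnMatrix (G.sum H) = fromBlocks (cnMatrix G) 0 0 (cnMatrix H) := by
  ext (v | v) (w | w)
  · have h : (G.sum H).commonNeighbors (.inl v) (.inl w) = Sum.inl '' G.commonNeighbors v w := by
      ext (x | x) <;> simp [SimpleGraph.mem_commonNeighbors]
    by_cases hvw : v = w <;>
      simp [cnMatrix, hvw, h, Set.ncard_image_of_injective _ Sum.inl_injective]
  · have h : (G.sum H).commonNeighbors (.inl v) (.inr w) = ∅ := by
      ext (x | x) <;> simp [SimpleGraph.mem_commonNeighbors]
    simp [cnMatrix, h]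
  · have h : (G.sum H).commonNeighbors (.inr v) (.inl w) = ∅ := by
      ext (x | x) <;> simp [SimpleGraph.mem_commonNeighbors]
    simp [cnMatrix, h]
  · have h : (G.sum H).commonNeighbors (.inr v) (.inr w) = Sum.inr '' H.commonNeighbors v w := by
      ext (x | x) <;> simp [SimpleGraph.mem_commonNeighbors]
    by_cases hvw : v = w <;>
      simp [cnMatrix, hvw, h, Set.ncard_image_of_injective _ Sum.inr_injective]

variable [Fintype V] [Fintype W]

theorem cnrsMatrix_sum :
    cnrsMatrix (G.sum H) = fromBlocks (cnrsMatrix G) 0 0 (cnrsMatrix H) := by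
  ext (v | v) (w | w)
  · by_cases hvw : v = w
    · simp [hvw, cnrsMatrix_apply_self, cnMatrix_sum]
    · simp [cnrsMatrix_apply_ne, hvw]
  · simp [cnrsMatrix_apply_ne]
  · simp [cnrsMatrix_apply_ne]
  · by_cases hvw : v = w
    · simp [hvw, cnrsMatrix_apply_self, cnMatrix_sum]
    · simp [cnrsMatrix_apply_ne, hvw]

open scoped Classical in
theorem cnlSpec_sum : cnlSpec (G.sum H) = cnlSpec G + cnlSpec H := by
  have h : cnlMatrix (G.sum H) = fromBlocks (cnlMatrix G) 0 0 (cnlMatrix H) := by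
    simp [cnlMatrix, cnMatrix_sum, cnrsMatrix_sum, sub_eq_add_neg, fromBlocks_neg, fromBlocks_add]
  rw [cnlSpec, cnlSpec, cnlSpec, h]
  convert Polynomial.roots_mul _ using 2
  · convert charpoly_fromBlocks_zero₁₂ ..
  · exact mul_ne_zero (charpoly_monic _).ne_zero (charpoly_monic _).ne_zero

open scoped Classical in
theorem cnslSpec_sum : cnslSpec (G.sum H) = cnslSpec G + cnslSpec H := by
  have h : cnslMatrix (G.sum H) = fromBlocks (cnslMatrix G) 0 0 (cnslMatrix H) := by
    simp [cnslMatrix, cnMatrix_sum, cnrsMatrix_sum, fromBlocks_add]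
  rw [cnslSpec, cnslSpec, cnslSpec, h]
  convert Polynomial.roots_mul _ using 2
  · convert charpoly_fromBlocks_zero₁₂ ..
  · exact mul_ne_zero (charpoly_monic _).ne_zero (charpoly_monic _).ne_zero

theorem trace_cnrsMatrix_sum :
    (cnrsMatrix (G.sum H)).trace = (cnrsMatrix G).trace + (cnrsMatrix H).trace := by
  simp [cnrsMatrix_sum, trace]

end Sum

/-! ### Copies of a complete graph -/

section Copies

variable (l n : ℕ)

/-- Two vertices of one clique see all the others, `m - 2` in number; writing `m = n + 2` avoids
truncated subtraction. -/
theorem cnMatrix_copiesOfComplete (v w : Fin l × Fin (n + 2)) :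
    cnMatrix (copiesOfComplete l (n + 2)) v w =
      if v.1 = w.1 ∧ v.2 ≠ w.2 then (n : ℝ) else 0 := by
  obtain ⟨a, i⟩ := v
  obtain ⟨b, j⟩ := w
  by_cases hab : a = b
  · subst hab
    by_cases hij : i = j
    · simp [cnMatrix, hij]
    · have h : (copiesOfComplete l (n + 2)).commonNeighbors (a, i) (a, j) =
          Prod.mk a '' ((({i, j} : Finset (Fin (n + 2)))ᶜ : Finset _) : Set (Fin (n + 2))) := by
        ext ⟨c, x⟩
        simp [SimpleGraph.mem_commonNeighbors, copiesOfComplete, Prod.ext_iff, eq_comm]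
        tauto
      simp [cnMatrix, hij, h, Set.ncard_image_of_injective _ (Prod.mk_right_injective a),
        Set.ncard_coe_finset, Finset.card_compl, -Finset.coe_compl]
  · have h : (copiesOfComplete l (n + 2)).commonNeighbors (a, i) (b, j) = ∅ := by
      ext ⟨c, x⟩
      simp only [SimpleGraph.mem_commonNeighbors, copiesOfComplete, Set.mem_empty_iff_false,
        iff_false]
      rintro ⟨⟨rfl, -⟩, rfl, -⟩
      exact hab rfl
    simp [cnMatrix, hab, h]

theorem cnrsMatrix_copiesOfComplete :
    cnrsMatrix (copiesOfComplete l (n + 2)) = scalar _ (((n : ℝ) + 1) * n) := by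
  ext v w
  by_cases hvw : v = w
  · subst hvw
    obtain ⟨a, i⟩ := v
    rw [cnrsMatrix_apply_self, scalar_apply, diagonal_apply_eq]
    simp only [cnMatrix_copiesOfComplete, Fintype.sum_prod_type, ite_and]
    rw [Finset.sum_eq_single a]
    · simp [Finset.sum_ite, Finset.filter_ne]
    · intro b _ hb
      exact Finset.sum_eq_zero fun j _ => if_neg (Ne.symm hb)
    · simp
  · rw [cnrsMatrix_apply_ne _ hvw, scalar_apply, diagonal_apply_ne _ hvw]

theorem trace_cnrsMatrix_copiesOfComplete :
    (cnrsMatrix (copiesOfComplete l (n + 2))).trace = (l : ℝ) * (n + 2) * ((n + 1) * n) := by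
  rw [cnrsMatrix_copiesOfComplete]
  simp [trace]

theorem cnlSpec_copiesOfComplete :
    cnlSpec (copiesOfComplete l (n + 2)) =
      Multiset.replicate l 0 + Multiset.replicate (l * (n + 1)) (((n : ℝ) + 2) * n) := by
  -- Each block is `m (m - 2) I - (m - 2) J`. The coordinates are swapped because `blockDiagonal`
  -- puts the block index second.
  have h : cnlMatrix (copiesOfComplete l (n + 2)) =
      reindex (Equiv.prodComm _ _) (Equiv.prodComm _ _) (blockDiagonal fun _ : Fin l =>
        vecMulVec (fun _ : Fin (n + 1 + 1) => -(n : ℝ)) 1 - scalar _ (-(((n : ℝ) + 2) * n))) := by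
    ext ⟨a, i⟩ ⟨b, j⟩
    by_cases hab : a = b <;> by_cases hij : i = j <;>
      simp [cnlMatrix, cnrsMatrix_copiesOfComplete, cnMatrix_copiesOfComplete, blockDiagonal_apply,
        hab, hij]
    ring
  classical
  have := roots_charpoly_blockDiagonal_const (l := l) (n := n + 1) (-(n : ℝ)) (-(((n : ℝ) + 2) * n))
  rw [cnlSpec, h]
  convert this using 2
  · convert charpoly_reindex ..
  · congr 1
    push_cast; ring
  · congr 1
    ring

theorem cnslSpec_copiesOfComplete :
    cnslSpec (copiesOfComplete l (n + 2)) =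
      Multiset.replicate l (2 * ((n : ℝ) + 1) * n) +
        Multiset.replicate (l * (n + 1)) ((n : ℝ) ^ 2) := by
  -- Each block is `(m - 2) ^ 2 I + (m - 2) J`.
  have h : cnslMatrix (copiesOfComplete l (n + 2)) =
      reindex (Equiv.prodComm _ _) (Equiv.prodComm _ _) (blockDiagonal fun _ : Fin l =>
        vecMulVec (fun _ : Fin (n + 1 + 1) => (n : ℝ)) 1 - scalar _ (-(n : ℝ) ^ 2)) := by
    ext ⟨a, i⟩ ⟨b, j⟩
    by_cases hab : a = b <;> by_cases hij : i = j <;>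
      simp [cnslMatrix, cnrsMatrix_copiesOfComplete, cnMatrix_copiesOfComplete,
        blockDiagonal_apply, hab, hij]
    ring
  classical
  have := roots_charpoly_blockDiagonal_const (l := l) (n := n + 1) (n : ℝ) (-(n : ℝ) ^ 2)
  rw [cnslSpec, h]
  convert this using 2
  · convert charpoly_reindex ..
  · congr 1
    push_cast; ring
  · congr 1
    ring

end Copies

end CommonNeighbourhood

/-! ### Spectra and `Δ` for the three clique types -/

namespace CommonNeighbourhood

/-- The graph `(q + 1) K_{q - 1} ⊔ h (q + 1) K_{q - 2} ⊔ h (q - 1) K_q`. -/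
abbrev threeCliqueTypes (q h : ℕ) :=
  SimpleGraph.sum
    (SimpleGraph.sum (copiesOfComplete (q + 1) (q - 1)) (copiesOfComplete (h * (q + 1)) (q - 2)))
    (copiesOfComplete (h * (q - 1)) q)

section

variable {q h : ℕ}

theorem cnlSpec_threeCliqueTypes (hq : 4 ≤ q) (hh : 2 * h = q) :
    cnlSpec (threeCliqueTypes q h) =
      Multiset.replicate (q + q ^ 2 + 1) (0 : ℝ) +
      Multiset.replicate ((q + 1) * (q - 2)) (((q : ℝ) - 1) * (q - 3)) +
      Multiset.replicate (h * (q + 1) * (q - 3)) (((q : ℝ) - 2) * (q - 4)) +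
      Multiset.replicate (h * (q - 1) ^ 2) ((q : ℝ) * (q - 2)) := by
  obtain ⟨n, rfl⟩ := Nat.exists_eq_add_of_le' hq
  -- The eigenvalue `0` occurs once per clique, and there are `q ^ 2 + q + 1` cliques.
  have h0 : n + 4 + (n + 4) ^ 2 + 1 = n + 4 + 1 + h * (n + 4 + 1) + h * (n + 3) := by
    have : h * (n + 4 + 1) + h * (n + 3) = (2 * h) * (n + 4) := by ring
    rw [add_assoc (n + 4 + 1), this, hh]
    ring
  have h1 : cnlSpec (copiesOfComplete (n + 4 + 1) (n + 4 - 1)) = _ :=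
    cnlSpec_copiesOfComplete (n + 4 + 1) (n + 1)
  have h2 : cnlSpec (copiesOfComplete (h * (n + 4 + 1)) (n + 4 - 2)) = _ :=
    cnlSpec_copiesOfComplete (h * (n + 4 + 1)) n
  have h3 : cnlSpec (copiesOfComplete (h * (n + 4 - 1)) (n + 4)) = _ :=
    cnlSpec_copiesOfComplete (h * (n + 3)) (n + 2)
  rw [threeCliqueTypes, cnlSpec_sum, cnlSpec_sum, h1, h2, h3, show n + 4 - 1 = n + 3 from rfl,
    show n + 4 - 2 = n + 2 from rfl, show n + 4 - 3 = n + 1 from rfl]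
  simp only [h0, Multiset.replicate_add _ _ (0 : ℝ)]
  push_cast
  ring_nf
  abel

theorem cnslSpec_threeCliqueTypes (hq : 4 ≤ q) :
    cnslSpec (threeCliqueTypes q h) =
      Multiset.replicate (q + 1) (2 * ((q : ℝ) - 2) * (q - 3)) +
      Multiset.replicate ((q + 1) * (q - 2)) (((q : ℝ) - 3) ^ 2) +
      Multiset.replicate (h * (q + 1)) (2 * ((q : ℝ) - 3) * (q - 4)) +
      Multiset.replicate (h * (q + 1) * (q - 3)) (((q : ℝ) - 4) ^ 2) +
      Multiset.replicate (h * (q - 1)) (2 * ((q : ℝ) - 1) * (q - 2)) +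
      Multiset.replicate (h * (q - 1) ^ 2) (((q : ℝ) - 2) ^ 2) := by
  obtain ⟨n, rfl⟩ := Nat.exists_eq_add_of_le' hq
  have h1 : cnslSpec (copiesOfComplete (n + 4 + 1) (n + 4 - 1)) = _ :=
    cnslSpec_copiesOfComplete (n + 4 + 1) (n + 1)
  have h2 : cnslSpec (copiesOfComplete (h * (n + 4 + 1)) (n + 4 - 2)) = _ :=
    cnslSpec_copiesOfComplete (h * (n + 4 + 1)) n
  have h3 : cnslSpec (copiesOfComplete (h * (n + 4 - 1)) (n + 4)) = _ :=
    cnslSpec_copiesOfComplete (h * (n + 3)) (n + 2)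
  rw [threeCliqueTypes, cnslSpec_sum, cnslSpec_sum, h1, h2, h3, show n + 4 - 1 = n + 3 from rfl,
    show n + 4 - 2 = n + 2 from rfl, show n + 4 - 3 = n + 1 from rfl]
  push_cast
  ring_nf
  abel

theorem cnDelta_threeCliqueTypes (hq : 4 ≤ q) (hh : 2 * h = q) :
    cnDelta (threeCliqueTypes q h) =
      (((q : ℝ) + 1) * (q - 1) * (q - 2) * (q - 3) +
        q * (q + 1) * (q - 2) * (q - 3) * (q - 4) / 2 +
        q * (q - 1) * q * (q - 1) * (q - 2) / 2) / ((q : ℝ) ^ 3 - q - 1) := by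
  obtain ⟨n, rfl⟩ := Nat.exists_eq_add_of_le' hq
  have hh' : (h : ℝ) = (n + 4) / 2 := by
    have : (2 : ℝ) * h = n + 4 := by exact_mod_cast hh
    linarith
  rw [cnDelta]
  have h1 : (cnrsMatrix (copiesOfComplete (n + 4 + 1) (n + 4 - 1))).trace = _ :=
    trace_cnrsMatrix_copiesOfComplete (n + 4 + 1) (n + 1)
  have h2 : (cnrsMatrix (copiesOfComplete (h * (n + 4 + 1)) (n + 4 - 2))).trace = _ :=
    trace_cnrsMatrix_copiesOfComplete (h * (n + 4 + 1)) n
  have h3 : (cnrsMatrix (copiesOfComplete (h * (n + 4 - 1)) (n + 4))).trace = _ :=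
    trace_cnrsMatrix_copiesOfComplete (h * (n + 3)) (n + 2)
  rw [trace_cnrsMatrix_sum, trace_cnrsMatrix_sum, h1, h2, h3]
  simp only [show n + 4 - 1 = n + 3 from rfl, show n + 4 - 2 = n + 2 from rfl, Fintype.card_sum,
    Fintype.card_prod, Fintype.card_fin]
  push_cast
  rw [hh']
  congr 1 <;> ring

end

/-! ### Energies -/

section Energy

variable {q h : ℕ}

theorem cnlEnergy_threeCliqueTypes (hq : 4 ≤ q) (hh : 2 * h = q) :
    cnlEnergy (threeCliqueTypes q h) =
      ((q : ℝ) - 2) * (19 * q - 4 * q ^ 3 + 12 * q ^ 2 - 7 * q ^ 4 - 5 * q ^ 5 + 3 * q ^ 6 + 6) /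
        ((q : ℝ) ^ 3 - q - 1) := by
  rw [cnlEnergy, cnlSpec_threeCliqueTypes hq hh, cnDelta_threeCliqueTypes hq hh]
  obtain ⟨n, rfl⟩ := Nat.exists_eq_add_of_le' hq
  have hh' : (h : ℝ) = (n + 4) / 2 := by
    have : (2 : ℝ) * h = n + 4 := by exact_mod_cast hh
    linarith
  have hn : (0 : ℝ) ≤ n := n.cast_nonneg
  simp only [Multiset.map_add, Multiset.map_replicate, Multiset.sum_add, Multiset.sum_replicate,
    nsmul_eq_mul, show n + 4 - 1 = n + 3 from rfl, show n + 4 - 2 = n + 2 from rfl,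
    show n + 4 - 3 = n + 1 from rfl]
  push_cast
  rw [hh']
  generalize (n : ℝ) = x at *
  have hd : 0 < (x + 4) ^ 3 - (x + 4) - 1 := by
    ring_nf; positivity
  -- Only `0` and `(q - 2)(q - 4)` lie below `Δ`. In `x = q - 4` each cleared difference has
  -- nonnegative coefficients, which is what `positivity` sees.
  rw [abs_of_nonpos, abs_of_nonneg, abs_of_nonpos, abs_of_nonneg]
  · generalize hD : (x + 4) ^ 3 - (x + 4) - 1 = D at *
    have := hd.ne'
    field_simp
    rw [← hD]
    ring
  · rw [sub_nonneg, div_le_iff₀ hd, ← sub_nonneg]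
    ring_nf; positivity
  · rw [sub_nonpos, le_div_iff₀ hd, ← sub_nonneg]
    ring_nf; positivity
  · rw [sub_nonneg, div_le_iff₀ hd, ← sub_nonneg]
    ring_nf; positivity
  · rw [sub_nonpos, le_div_iff₀ hd, ← sub_nonneg]
    ring_nf; positivity

/-- Here `Δ = 174 / 59` exceeds the eigenvalue `2 (q - 3)(q - 4) = 0`, whereas for `q ≥ 8` that
eigenvalue is at least `Δ`; this one sign change makes `q = 4` exceptional. -/
theorem cnslEnergy_threeCliqueTypes_four : cnslEnergy (threeCliqueTypes 4 2) = 9260 / 59 := by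
  rw [cnslEnergy, cnslSpec_threeCliqueTypes le_rfl, cnDelta_threeCliqueTypes le_rfl rfl]
  simp only [Multiset.map_add, Multiset.map_replicate, Multiset.sum_add, Multiset.sum_replicate,
    nsmul_eq_mul]
  norm_num [abs_of_nonneg, abs_of_nonpos]

theorem cnslEnergy_threeCliqueTypes (hq : 8 ≤ q) (hh : 2 * h = q) :
    cnslEnergy (threeCliqueTypes q h) =
      (-20 * (q : ℝ) + 14 * q ^ 3 + 32 * q ^ 4 - 9 * q ^ 2 + q ^ 5 - 13 * q ^ 6 + 3 * q ^ 7 - 12) /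
        ((q : ℝ) ^ 3 - q - 1) := by
  rw [cnslEnergy, cnslSpec_threeCliqueTypes (by lia), cnDelta_threeCliqueTypes (by lia) hh]
  obtain ⟨n, rfl⟩ := Nat.exists_eq_add_of_le' hq
  have hh' : (h : ℝ) = (n + 8) / 2 := by
    have : (2 : ℝ) * h = n + 8 := by exact_mod_cast hh
    linarith
  have hn : (0 : ℝ) ≤ n := n.cast_nonneg
  simp only [Multiset.map_add, Multiset.map_replicate, Multiset.sum_add, Multiset.sum_replicate,
    nsmul_eq_mul, show n + 8 - 1 = n + 7 from rfl, show n + 8 - 2 = n + 6 from rfl,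
    show n + 8 - 3 = n + 5 from rfl]
  push_cast
  rw [hh']
  generalize (n : ℝ) = x at *
  have hd : 0 < (x + 8) ^ 3 - (x + 8) - 1 := by
    ring_nf; positivity
  rw [abs_of_nonneg, abs_of_nonpos, abs_of_nonneg, abs_of_nonpos, abs_of_nonneg, abs_of_nonneg]
  · generalize hD : (x + 8) ^ 3 - (x + 8) - 1 = D at *
    have := hd.ne'
    field_simp
    rw [← hD]
    ring
  · rw [sub_nonneg, div_le_iff₀ hd, ← sub_nonneg]
    ring_nf; positivity
  · rw [sub_nonneg, div_le_iff₀ hd, ← sub_nonneg]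
    ring_nf; positivity
  · rw [sub_nonpos, le_div_iff₀ hd, ← sub_nonneg]
    ring_nf; positivity
  · rw [sub_nonneg, div_le_iff₀ hd, ← sub_nonneg]
    ring_nf; positivity
  · rw [sub_nonpos, le_div_iff₀ hd, ← sub_nonneg]
    ring_nf; positivity
  · rw [sub_nonneg, div_le_iff₀ hd, ← sub_nonneg]
    ring_nf; positivity

end Energy

end CommonNeighbourhood

/-! ### Disjoint unions of cliques -/

namespace CommonNeighbourhood

section CliqueUnion

variable {ι κ : Type*}

/-- The disjoint union of the complete graphs on the types `X i`. -/
def cliqueUnion (X : ι → Type*) : SimpleGraph (Σ i, X i) where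
  Adj x y := x.1 = y.1 ∧ x ≠ y
  symm := ⟨fun _ _ h => ⟨h.1.symm, h.2.symm⟩⟩
  loopless := ⟨fun _ h => h.2 rfl⟩

theorem cliqueUnion_adj (X : ι → Type*) (x y : Σ i, X i) :
    (cliqueUnion X).Adj x y ↔ x.1 = y.1 ∧ x ≠ y :=
  Iff.rfl

/-- Reindexing the components of a disjoint union of complete graphs. -/
def cliqueUnionReindex (X : κ → Type*) (e : ι ≃ κ) :
    cliqueUnion (fun i => X (e i)) ≃g cliqueUnion X where
  toEquiv := Equiv.sigmaCongrLeft e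
  map_rel_iff' {x y} := by
    rw [cliqueUnion_adj, cliqueUnion_adj, (Equiv.sigmaCongrLeft e).injective.ne_iff]
    exact and_congr_left fun _ => e.injective.eq_iff

/-- A disjoint union of complete graphs indexed by a sum type is the sum of two such graphs. -/
def cliqueUnionSum (X : ι ⊕ κ → Type*) :
    cliqueUnion X ≃g
      (cliqueUnion fun i => X (.inl i)).sum (cliqueUnion fun i => X (.inr i)) where
  toEquiv := Equiv.sumSigmaDistrib X
  map_rel_iff' {x y} := by
    obtain ⟨i | i, x⟩ := x <;> obtain ⟨j | j, y⟩ := y <;>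
      simp [cliqueUnion_adj, Equiv.sumSigmaDistrib]

theorem nonempty_cliqueUnion_iso_copiesOfComplete [Finite ι] (X : ι → Type*) [∀ i, Finite (X i)]
    {l m : ℕ} (hl : Nat.card ι = l) (hm : ∀ i, Nat.card (X i) = m) :
    Nonempty (cliqueUnion X ≃g copiesOfComplete l m) := by
  let e : (Σ i, X i) ≃ Fin l × Fin m :=
    ((Equiv.sigmaCongrRight fun i => Finite.equivFinOfCardEq (hm i)).trans
      (Equiv.sigmaEquivProd ι (Fin m))).trans
      ((Finite.equivFinOfCardEq hl).prodCongr (Equiv.refl _))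
  refine ⟨⟨e, fun {x y} => ?_⟩⟩
  have h1 : (e x).1 = (e y).1 ↔ x.1 = y.1 := (Finite.equivFinOfCardEq hl).injective.eq_iff
  have h2 : (copiesOfComplete l m).Adj (e x) (e y) ↔ (e x).1 = (e y).1 ∧ e x ≠ e y := by
    rw [Ne, Prod.ext_iff, copiesOfComplete]
    tauto
  rw [h2, h1, e.injective.ne_iff, cliqueUnion_adj]

/-- Isomorphic groups have isomorphic commuting graphs. -/
def commutingGraphCongr {G H : Type*} [Group G] [Group H] (e : G ≃* H) :
    commutingGraph G ≃g commutingGraph H where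
  toEquiv := e.toEquiv.subtypeEquiv fun g => not_congr <| by
    simp only [Subgroup.mem_center_iff, e.surjective.forall]
    exact forall_congr' fun x => by
      rw [← e.injective.eq_iff, map_mul, map_mul]; rfl
  map_rel_iff' {x y} := by
    refine and_congr (Equiv.injective _).ne_iff ?_
    rw [← e.injective.eq_iff, map_mul, map_mul]
    rfl

end CliqueUnion

/-! ### Commuting in `SL(2, F)` and the projective plane -/

section SpecialLinear

variable {F : Type*} [Field F]

open Matrix

/-- Points of the projective plane `ℙ²(F)`, in normalised coordinates. -/
abbrev PlanePoint (F : Type*) := Option F ⊕ (F × F)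

namespace PlanePoint

/-- The first normalised coordinate. -/
def fst : PlanePoint F → F := Sum.elim (fun _ => 0) (fun _ => 1)

/-- The second normalised coordinate. -/
def snd : PlanePoint F → F := Sum.elim (fun o => o.elim 0 fun _ => 1) Prod.fst

/-- The third normalised coordinate. -/
def thd : PlanePoint F → F := Sum.elim (fun o => o.elim 1 id) Prod.snd

theorem ne_zero (i : PlanePoint F) : ¬ (i.fst = 0 ∧ i.snd = 0 ∧ i.thd = 0) := by
  obtain (_ | c) | ⟨b, c⟩ := i <;> simp [fst, snd, thd]

/-- The hypotheses say that all `2 × 2` minors vanish; a normalised triple has first nonzero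
coordinate `1`, so proportional triples coincide. -/
theorem eq_of_proportional {i j : PlanePoint F} (h1 : i.fst * j.snd = j.fst * i.snd)
    (h2 : i.fst * j.thd = j.fst * i.thd) (h3 : i.snd * j.thd = j.snd * i.thd) : i = j := by
  obtain (_ | c) | ⟨b, c⟩ := i <;> obtain (_ | c') | ⟨b', c'⟩ := j <;>
    simp_all [fst, snd, thd]

theorem exists_scalar {a b c : F} (h : ¬ (a = 0 ∧ b = 0 ∧ c = 0)) :
    ∃ (i : PlanePoint F) (y : F), y ≠ 0 ∧ a = y * i.fst ∧ b = y * i.snd ∧ c = y * i.thd := by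
  by_cases ha : a = 0
  · by_cases hb : b = 0
    · exact ⟨.inl none, c, by tauto, by simp [fst, snd, thd, ha, hb]⟩
    · exact ⟨.inl (some (c / b)), b, hb, by simp [fst, snd, thd, ha, hb, mul_div_cancel₀]⟩
  · exact ⟨.inr (b / a, c / a), a, ha, by simp [fst, snd, thd, ha, mul_div_cancel₀]⟩

theorem scalar_unique {i : PlanePoint F} {y z : F} (h1 : y * i.fst = z * i.fst)
    (h2 : y * i.snd = z * i.snd) (h3 : y * i.thd = z * i.thd) : y = z := by
  have := i.ne_zero
  by_contra h
  simp_all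

/-- The polynomial function `t ↦ det (t + N)` where `N` is the matrix attached to `i`. -/
def detAt (i : PlanePoint F) (t : F) : F := (t + i.fst) * t - i.snd * i.thd

end PlanePoint

theorem mem_center_specialLinearGroup_two_iff {A : Matrix.SpecialLinearGroup (Fin 2) F} :
    A ∈ Subgroup.center (Matrix.SpecialLinearGroup (Fin 2) F) ↔
      A 0 0 - A 1 1 = 0 ∧ A 0 1 = 0 ∧ A 1 0 = 0 := by
  rw [Matrix.SpecialLinearGroup.mem_center_iff]
  constructor
  · rintro ⟨r, -, h⟩
    simp [← h]
  · rintro ⟨h1, h2, h3⟩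
    have h := A.det_coe
    rw [det_fin_two, h2, h3, ← sub_eq_zero.1 h1] at h
    refine ⟨A 0 0, by simpa [pow_two] using h, ?_⟩
    ext i j
    fin_cases i <;> fin_cases j <;> simp [h2, h3, sub_eq_zero.1 h1]

/-- Up to sign, the off-diagonal entries of `AB - BA` are the first two minors of the triples `(a -
d, b, c)`, and its diagonal entries are the third. -/
theorem specialLinearGroup_two_commute_iff (A B : Matrix.SpecialLinearGroup (Fin 2) F) :
    A * B = B * A ↔
      (A 0 0 - A 1 1) * B 0 1 = (B 0 0 - B 1 1) * A 0 1 ∧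
      (A 0 0 - A 1 1) * B 1 0 = (B 0 0 - B 1 1) * A 1 0 ∧
      A 0 1 * B 1 0 = B 0 1 * A 1 0 := by
  rw [Matrix.SpecialLinearGroup.ext_iff]
  simp only [Matrix.SpecialLinearGroup.coe_mul, Fin.forall_fin_two, mul_apply, Fin.sum_univ_two]
  constructor
  · rintro ⟨⟨h1, h2⟩, h3, h4⟩
    refine ⟨?_, ?_, ?_⟩
    · linear_combination h2
    · linear_combination -h3
    · linear_combination h1
  · rintro ⟨h1, h2, h3⟩
    refine ⟨⟨?_, ?_⟩, ?_, ?_⟩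
    · linear_combination h3
    · linear_combination h1
    · linear_combination -h2
    · linear_combination -h3

variable [CharP F 2]

variable (F) in
theorem center_specialLinearGroup_two_eq_bot :
    Subgroup.center (Matrix.SpecialLinearGroup (Fin 2) F) = ⊥ := by
  rw [eq_bot_iff]
  intro A hA
  obtain ⟨r, h1, h2⟩ := Matrix.SpecialLinearGroup.mem_center_iff.1 hA
  have hr : r = 1 := by
    rw [Fintype.card_fin] at h1
    rcases sq_eq_one_iff.1 h1 with h | h <;> simp [h, CharTwo.neg_eq]
  rw [Subgroup.mem_bot]
  ext i j
  simp [← h2, hr]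

variable [Finite F]

theorem exists_sq_mul_eq_one {d : F} (hd : d ≠ 0) : ∃ r : F, r * r * d = 1 := by
  obtain ⟨r, hr⟩ := FiniteField.isSquare_of_char_two (ringChar.eq F 2) d⁻¹
  exact ⟨r, by rw [← hr, inv_mul_cancel₀ hd]⟩

/-- The non-central element of `SL(2, F)` proportional to `t + N`, where `N` is the matrix
attached to the point `i`. -/
noncomputable def nonCentralOfPoint (x : Σ i : PlanePoint F, {t : F // i.detAt t ≠ 0}) :
    NonCentral (Matrix.SpecialLinearGroup (Fin 2) F) :=
  let r := (exists_sq_mul_eq_one x.2.2).choose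
  have hr : r * r * x.1.detAt x.2 = 1 := (exists_sq_mul_eq_one x.2.2).choose_spec
  ⟨⟨r • !![x.2.1 + x.1.fst, x.1.snd; x.1.thd, x.2.1], by
      rw [← hr, det_smul, det_fin_two_of, PlanePoint.detAt, Fintype.card_fin, pow_two]⟩, fun h => by
    have h0 : r ≠ 0 := by
      intro h
      simp [h] at hr
    exact x.1.ne_zero <| by
      simpa [h0, ← mul_sub] using mem_center_specialLinearGroup_two_iff.1 h⟩

theorem nonCentralOfPoint_spec (x : Σ i : PlanePoint F, {t : F // i.detAt t ≠ 0}) :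
    ∃ r : F, r ≠ 0 ∧ (nonCentralOfPoint x).1.1 0 0 = r * (x.2.1 + x.1.fst) ∧
      (nonCentralOfPoint x).1.1 0 1 = r * x.1.snd ∧
      (nonCentralOfPoint x).1.1 1 0 = r * x.1.thd ∧
      (nonCentralOfPoint x).1.1 1 1 = r * x.2.1 := by
  have hr := (exists_sq_mul_eq_one x.2.2).choose_spec
  refine ⟨(exists_sq_mul_eq_one x.2.2).choose, fun h => ?_, ?_⟩
  · simp [h] at hr
  · simp [nonCentralOfPoint]

theorem nonCentralOfPoint_commute_iff (x y : Σ i : PlanePoint F, {t : F // i.detAt t ≠ 0}) :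
    (nonCentralOfPoint x).1 * (nonCentralOfPoint y).1 =
      (nonCentralOfPoint y).1 * (nonCentralOfPoint x).1 ↔ x.1 = y.1 := by
  obtain ⟨r, hr, a1, a2, a3, a4⟩ := nonCentralOfPoint_spec x
  obtain ⟨s, hs, b1, b2, b3, b4⟩ := nonCentralOfPoint_spec y
  have hrs : r * s ≠ 0 := mul_ne_zero hr hs
  rw [specialLinearGroup_two_commute_iff, a1, a2, a3, a4, b1, b2, b3, b4]
  constructor
  · rintro ⟨h1, h2, h3⟩
    apply PlanePoint.eq_of_proportional <;> apply mul_left_cancel₀ hrs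
    · linear_combination h1
    · linear_combination h2
    · linear_combination h3
  · intro h
    obtain ⟨i, t⟩ := x
    obtain ⟨j, u⟩ := y
    obtain rfl : i = j := h
    refine ⟨?_, ?_, ?_⟩ <;> ring

theorem nonCentralOfPoint_injective :
    Function.Injective (nonCentralOfPoint (F := F)) := by
  intro x y hxy
  have hi := (nonCentralOfPoint_commute_iff x y).1 (by rw [hxy])
  obtain ⟨i, t, ht⟩ := x
  obtain ⟨j, u, hu⟩ := y
  obtain rfl : i = j := hi
  obtain ⟨r, hr, a1, a2, a3, a4⟩ := nonCentralOfPoint_spec ⟨i, t, ht⟩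
  obtain ⟨s, hs, b1, b2, b3, b4⟩ := nonCentralOfPoint_spec ⟨i, u, hu⟩
  rw [hxy] at a1 a2 a3 a4
  simp only at a1 a2 a3 a4 b1 b2 b3 b4
  -- Subtracting the diagonal entries removes `t` and `u` and leaves `r * i.fst = s * i.fst`.
  obtain rfl : r = s := PlanePoint.scalar_unique (i := i)
    (by linear_combination b1 - a1 - b4 + a4) (a2.symm.trans b2) (a3.symm.trans b3)
  obtain rfl : t = u := mul_left_cancel₀ hr (a4.symm.trans b4)
  rfl

theorem nonCentralOfPoint_surjective :
    Function.Surjective (nonCentralOfPoint (F := F)) := by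
  rintro ⟨A, hA⟩
  have hA' := hA
  rw [mem_center_specialLinearGroup_two_iff] at hA'
  obtain ⟨i, y, hy, h1, h2, h3⟩ := PlanePoint.exists_scalar hA'
  have hdet : A 0 0 * A 1 1 - A 0 1 * A 1 0 = 1 := by
    rw [← det_fin_two, A.det_coe]
  have hA0 : A 0 0 = y * (A 1 1 / y + i.fst) := by
    field_simp
    linear_combination h1
  have hA1 : A 1 1 = y * (A 1 1 / y) := (mul_div_cancel₀ _ hy).symm
  have hyd : y * y * i.detAt (A 1 1 / y) = 1 := by
    rw [h2, h3, hA0] at hdet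
    rw [PlanePoint.detAt]
    linear_combination hdet - y * (A 1 1 / y + i.fst) * hA1
  have ht : i.detAt (A 1 1 / y) ≠ 0 := by
    intro h
    simp [h] at hyd
  refine ⟨⟨i, A 1 1 / y, ht⟩, ?_⟩
  obtain ⟨r, hr, a1, a2, a3, a4⟩ := nonCentralOfPoint_spec ⟨i, A 1 1 / y, ht⟩
  have hB := (nonCentralOfPoint ⟨i, A 1 1 / y, ht⟩).1.det_coe
  rw [det_fin_two, a1, a2, a3, a4] at hB
  -- Both scalars normalise the same determinant, so their squares agree; in characteristic two this
  -- forces equality.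
  have hry : r = y := by
    have h : r * r = y * y := by
      apply mul_right_cancel₀ ht
      rw [hyd, PlanePoint.detAt]
      linear_combination hB
    rcases mul_self_eq_mul_self_iff.1 h with h | h
    · exact h
    · rw [h, CharTwo.neg_eq]
  subst hry
  ext a b
  fin_cases a <;> fin_cases b
  · exact a1.trans hA0.symm
  · exact a2.trans h2.symm
  · exact a3.trans h3.symm
  · exact a4.trans hA1.symm

variable (F) in
/-- The commuting graph of `SL(2, F)` in even characteristic: its components are the complete
graphs on the non-central parts of the centralizers. -/
noncomputable def commutingGraphSL₂Iso :
    cliqueUnion (fun i : PlanePoint F => {t : F // i.detAt t ≠ 0}) ≃g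
      commutingGraph (Matrix.SpecialLinearGroup (Fin 2) F) where
  toEquiv := Equiv.ofBijective nonCentralOfPoint
    ⟨nonCentralOfPoint_injective, nonCentralOfPoint_surjective⟩
  map_rel_iff' {x y} := by
    rw [cliqueUnion_adj, ← nonCentralOfPoint_commute_iff, ← nonCentralOfPoint_injective.ne_iff]
    exact and_comm

end SpecialLinear

end CommonNeighbourhood

/-! ### Clique sizes and the number of cliques of each size -/

namespace CommonNeighbourhood

section Counting

variable {F : Type*} [Field F]

theorem detAt_inr_eq_zero_iff (p : F × F) (t : F) :
    PlanePoint.detAt (.inr p) t = 0 ↔ t * (t + 1) = p.1 * p.2 := by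
  rw [PlanePoint.detAt, sub_eq_zero, mul_comm]
  rfl

/-- In characteristic two the difference of the sides factors as `(t - r)(t - (r + 1))`. -/
theorem mul_add_one_eq_iff [CharP F 2] (t r : F) :
    t * (t + 1) = r * (r + 1) ↔ t = r ∨ t = r + 1 := by
  rw [← sub_eq_zero, ← sub_eq_zero (a := t) (b := r), ← sub_eq_zero (a := t) (b := r + 1),
    ← mul_eq_zero]
  have h2 : (2 : F) = 0 := CharTwo.two_eq_zero
  constructor <;> intro h
  · linear_combination h + (r ^ 2 + r - t * r - t) * h2
  · linear_combination h - (r ^ 2 + r - t * r - t) * h2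

variable [Finite F]

theorem natCard_detAt_ne_zero (i : PlanePoint F) :
    Nat.card {t : F // i.detAt t ≠ 0} = Nat.card F - {t : F | i.detAt t = 0}.ncard :=
  Set.ncard_compl {t : F | i.detAt t = 0}

theorem natCard_detAt_ne_zero_of_no_root {p : F × F} (h : ¬ ∃ t, t * (t + 1) = p.1 * p.2) :
    Nat.card {t : F // PlanePoint.detAt (.inr p) t ≠ 0} = Nat.card F := by
  rw [natCard_detAt_ne_zero, (Set.ncard_eq_zero (Set.toFinite _)).2, Nat.sub_zero]
  exact Set.eq_empty_of_forall_notMem fun t ht => h ⟨t, (detAt_inr_eq_zero_iff p t).1 ht⟩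

variable [CharP F 2]

theorem natCard_detAt_ne_zero_inl (o : Option F) :
    Nat.card {t : F // PlanePoint.detAt (.inl o) t ≠ 0} = Nat.card F - 1 := by
  rw [natCard_detAt_ne_zero]
  congr 1
  rw [Set.ncard_eq_one]
  -- With first coordinate `0` the equation is `t ^ 2 = r ^ 2`, whose only root is `r`.
  obtain ⟨r, hr⟩ := FiniteField.isSquare_of_char_two (ringChar.eq F 2)
    (PlanePoint.snd (.inl o) * PlanePoint.thd (.inl o))
  refine ⟨r, Set.ext fun t => ?_⟩
  rw [Set.mem_ofPred_eq, PlanePoint.detAt, hr, Set.mem_singleton_iff]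
  simp [PlanePoint.fst, sub_eq_zero, mul_self_eq_mul_self_iff, CharTwo.neg_eq]

theorem natCard_detAt_ne_zero_of_root {p : F × F} (h : ∃ t, t * (t + 1) = p.1 * p.2) :
    Nat.card {t : F // PlanePoint.detAt (.inr p) t ≠ 0} = Nat.card F - 2 := by
  rw [natCard_detAt_ne_zero]
  congr 1
  rw [Set.ncard_eq_two]
  obtain ⟨r, hr⟩ := h
  refine ⟨r, r + 1, by simp, Set.ext fun t => ?_⟩
  rw [Set.mem_ofPred_eq, detAt_inr_eq_zero_iff, ← hr, mul_add_one_eq_iff, Set.mem_insert_iff,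
    Set.mem_singleton_iff]

variable (F) in
-- Both sides count triples `(t, b, c)` with `t (t + 1) = b c`. A solvable pair `(b, c)` has two
-- roots; conversely `b ≠ 0` determines `c` from `t`, giving `q (q - 1)`, and `b = 0` forces `t` to
-- be `0` or `1` with `c` free, giving `2 q`.
theorem two_mul_natCard_root :
    2 * Nat.card {p : F × F // ∃ t, t * (t + 1) = p.1 * p.2} = Nat.card F * (Nat.card F + 1) := by
  classical
  have := Fintype.ofFinite F
  have h1 (p : F × F) : (∑ t : F, if t * (t + 1) = p.1 * p.2 then 1 else 0) =
      if ∃ t, t * (t + 1) = p.1 * p.2 then 2 else 0 := by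
    split_ifs with h
    · obtain ⟨r, hr⟩ := h
      have : Finset.univ.filter (fun t : F => t * (t + 1) = p.1 * p.2) = {r, r + 1} := by
        ext t
        simp [← hr, mul_add_one_eq_iff]
      rw [← Finset.card_filter, this, Finset.card_pair (by simp)]
    · exact Finset.sum_eq_zero fun t _ => if_neg fun ht => h ⟨t, ht⟩
  have h2 (t b : F) : (∑ c : F, if t * (t + 1) = b * c then 1 else 0) =
      (if b ≠ 0 then 1 else 0) +
        if b = 0 then (if t = 0 ∨ t = 1 then Fintype.card F else 0) else 0 := by
    by_cases hb : b = 0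
    · have : t = 0 ∨ t = 1 ↔ t * (t + 1) = 0 := by
        rw [mul_eq_zero, ← CharTwo.sub_eq_add, sub_eq_zero]
      simp only [hb, zero_mul, this]
      split_ifs <;> simp_all
    · have (c : F) : t * (t + 1) = b * c ↔ c = t * (t + 1) / b := by
        rw [eq_div_iff hb, eq_comm, mul_comm]
      simp [this, hb]
  have h3 : Finset.univ.filter (fun t : F => t = 0 ∨ t = 1) = {0, 1} := by
    ext t
    simp
  have h4 : 1 ≤ Fintype.card F := Fintype.card_pos
  calc 2 * Nat.card {p : F × F // ∃ t, t * (t + 1) = p.1 * p.2}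
      = ∑ p : F × F, ∑ t : F, if t * (t + 1) = p.1 * p.2 then 1 else 0 := by
        simp only [h1]
        rw [Nat.card_eq_fintype_card, Fintype.card_subtype, ← Finset.sum_filter, Finset.sum_const,
          smul_eq_mul, mul_comm]
    _ = ∑ t : F, ∑ b : F, ∑ c : F, if t * (t + 1) = b * c then 1 else 0 := by
        rw [Finset.sum_comm]
        simp only [Fintype.sum_prod_type]
    _ = Fintype.card F * (Fintype.card F - 1) + 2 * Fintype.card F := by
        simp only [h2, Finset.sum_add_distrib, Finset.sum_ite_eq', Finset.mem_univ, if_true,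
          Finset.filter_ne', Finset.card_erase_of_mem, Finset.card_univ, Finset.sum_const,
          ← Finset.sum_filter, h3, Finset.card_pair (zero_ne_one (α := F)), smul_eq_mul, mul_one]
    _ = Nat.card F * (Nat.card F + 1) := by
        rw [Nat.card_eq_fintype_card]
        obtain ⟨m, hm⟩ := Nat.exists_eq_add_of_le' h4
        rw [hm, Nat.add_sub_cancel]
        ring

variable (F) in
/-- The commuting graph of `PSL(2, F)` for a finite field `F` of even order `2 h`. -/
theorem nonempty_commutingGraph_PSL₂_iso {h : ℕ} (hF : 2 * h = Nat.card F) :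
    Nonempty (commutingGraph (Matrix.ProjectiveSpecialLinearGroup (Fin 2) F) ≃g
      threeCliqueTypes (Nat.card F) h) := by
  let S (p : F × F) : Prop := ∃ t, t * (t + 1) = p.1 * p.2
  let X (i : PlanePoint F) : Type _ := {t : F // i.detAt t ≠ 0}
  have hS : Nat.card {p // S p} = h * (Nat.card F + 1) := by
    have := two_mul_natCard_root F
    rw [← hF] at this ⊢
    exact Nat.mul_left_cancel two_pos (this.trans (mul_assoc _ _ _))
  have hN : Nat.card {p // ¬ S p} = h * (Nat.card F - 1) := by
    have h1 : Nat.card {p // S p} + Nat.card {p // ¬ S p} = Nat.card F * Nat.card F := by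
      classical
      rw [← Nat.card_sum, ← Nat.card_prod]
      exact Nat.card_congr (Equiv.sumCompl S)
    have h2 : 1 ≤ Nat.card F := Nat.card_pos
    rw [hS] at h1
    zify [h2] at h1 hF ⊢
    linear_combination h1 - (Nat.card F : ℤ) * hF
  classical
  -- The points are grouped by the number of roots: one, two, none.
  let σ : (Option F ⊕ {p // S p}) ⊕ {p // ¬ S p} ≃ PlanePoint F :=
    (Equiv.sumAssoc _ _ _).trans (Equiv.sumCongr (Equiv.refl _) (Equiv.sumCompl S))
  obtain ⟨e1⟩ := nonempty_cliqueUnion_iso_copiesOfComplete (fun o => X (σ (.inl (.inl o))))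
    (Finite.card_option (α := F)) natCard_detAt_ne_zero_inl
  obtain ⟨e2⟩ := nonempty_cliqueUnion_iso_copiesOfComplete (fun p => X (σ (.inl (.inr p))))
    hS fun p => natCard_detAt_ne_zero_of_root p.2
  obtain ⟨e3⟩ := nonempty_cliqueUnion_iso_copiesOfComplete (fun p => X (σ (.inr p)))
    hN fun p => natCard_detAt_ne_zero_of_no_root p.2
  have e4 := (cliqueUnionSum fun i => X (σ i)).trans
    (SimpleGraph.Iso.sumCongr ((cliqueUnionSum fun i => X (σ (.inl i))).trans
      (SimpleGraph.Iso.sumCongr e1 e2)) e3)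
  have e5 := commutingGraphCongr
    ((QuotientGroup.quotientMulEquivOfEq (center_specialLinearGroup_two_eq_bot F)).trans
      QuotientGroup.quotientBot)
  exact ⟨e5.trans <| (commutingGraphSL₂Iso F).symm.trans <|
    (cliqueUnionReindex X σ).symm.trans e4⟩

end Counting

end CommonNeighbourhood

/-! ### The proposition -/

theorem mainTheorem6 (k : ℕ) (hk : 2 ≤ k) (F : Type*) [Field F] [Finite F]
    (hF : Nat.card F = 2 ^ k) :
    Nonempty
      (CommonNeighbourhood.commutingGraph (Matrix.ProjectiveSpecialLinearGroup (Fin 2) F) ≃g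
        SimpleGraph.sum
          (SimpleGraph.sum
            (CommonNeighbourhood.copiesOfComplete (2 ^ k + 1) (2 ^ k - 1))
            (CommonNeighbourhood.copiesOfComplete (2 ^ (k - 1) * (2 ^ k + 1)) (2 ^ k - 2)))
          (CommonNeighbourhood.copiesOfComplete (2 ^ (k - 1) * (2 ^ k - 1)) (2 ^ k))) ∧
    CommonNeighbourhood.cnlSpec
        (CommonNeighbourhood.commutingGraph (Matrix.ProjectiveSpecialLinearGroup (Fin 2) F)) =
      Multiset.replicate (2 ^ k + 2 ^ (2 * k) + 1) (0 : ℝ) +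
      Multiset.replicate ((2 ^ k + 1) * (2 ^ k - 2)) (((2 : ℝ) ^ k - 1) * ((2 : ℝ) ^ k - 3)) +
      Multiset.replicate (2 ^ (k - 1) * (2 ^ k + 1) * (2 ^ k - 3))
        (((2 : ℝ) ^ k - 2) * ((2 : ℝ) ^ k - 4)) +
      Multiset.replicate (2 ^ (k - 1) * (2 ^ k - 1) ^ 2) ((2 : ℝ) ^ k * ((2 : ℝ) ^ k - 2)) ∧
    CommonNeighbourhood.cnslSpec
        (CommonNeighbourhood.commutingGraph (Matrix.ProjectiveSpecialLinearGroup (Fin 2) F)) =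
      Multiset.replicate (2 ^ k + 1) (2 * ((2 : ℝ) ^ k - 2) * ((2 : ℝ) ^ k - 3)) +
      Multiset.replicate ((2 ^ k + 1) * (2 ^ k - 2)) (((2 : ℝ) ^ k - 3) ^ 2) +
      Multiset.replicate (2 ^ (k - 1) * (2 ^ k + 1))
        (2 * ((2 : ℝ) ^ k - 3) * ((2 : ℝ) ^ k - 4)) +
      Multiset.replicate (2 ^ (k - 1) * (2 ^ k + 1) * (2 ^ k - 3)) (((2 : ℝ) ^ k - 4) ^ 2) +
      Multiset.replicate (2 ^ (k - 1) * (2 ^ k - 1))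
        (2 * ((2 : ℝ) ^ k - 1) * ((2 : ℝ) ^ k - 2)) +
      Multiset.replicate (2 ^ (k - 1) * (2 ^ k - 1) ^ 2) (((2 : ℝ) ^ k - 2) ^ 2) ∧
    CommonNeighbourhood.cnlEnergy
        (CommonNeighbourhood.commutingGraph (Matrix.ProjectiveSpecialLinearGroup (Fin 2) F)) =
      ((2 : ℝ) ^ k - 2) *
        (19 * (2 : ℝ) ^ k - (2 : ℝ) ^ (3 * k + 2) + 3 * (4 : ℝ) ^ (k + 1) - 7 * (16 : ℝ) ^ k
          - 5 * (32 : ℝ) ^ k + 3 * (64 : ℝ) ^ k + 6) /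
        ((8 : ℝ) ^ k - (2 : ℝ) ^ k - 1) ∧
    (k = 2 →
      CommonNeighbourhood.cnslEnergy
        (CommonNeighbourhood.commutingGraph (Matrix.ProjectiveSpecialLinearGroup (Fin 2) F)) =
      9260 / 59) ∧
    (3 ≤ k →
      CommonNeighbourhood.cnslEnergy
        (CommonNeighbourhood.commutingGraph (Matrix.ProjectiveSpecialLinearGroup (Fin 2) F)) =
      (-5 * (2 : ℝ) ^ (k + 2) + 7 * (2 : ℝ) ^ (3 * k + 1) + (2 : ℝ) ^ (4 * k + 5)
          - 9 * (4 : ℝ) ^ k + (32 : ℝ) ^ k - 13 * (64 : ℝ) ^ k + 3 * (128 : ℝ) ^ k - 12) /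
        ((8 : ℝ) ^ k - (2 : ℝ) ^ k - 1)) := by
  have := Fintype.ofFinite F
  have : CharP F 2 := by
    have : Fact (Nat.Prime 2) := ⟨Nat.prime_two⟩
    exact charP_of_card_eq_prime_pow (Fintype.card_eq_nat_card.trans hF)
  have hh : 2 * 2 ^ (k - 1) = 2 ^ k := by rw [← pow_succ', Nat.sub_add_cancel (by lia)]
  have hq : 4 ≤ 2 ^ k := Nat.pow_le_pow_right two_pos hk
  obtain ⟨e⟩ := CommonNeighbourhood.nonempty_commutingGraph_PSL₂_iso F (hh.trans hF.symm)
  rw [hF] at e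
  -- All exponentials become powers of `q = 2 ^ k`, turning the energy formulas into polynomial
  -- identities.
  have hpow (a b : ℕ) (h : a = 2 ^ b) : (a : ℝ) ^ k = ((2 : ℝ) ^ k) ^ b := by
    rw [h, Nat.cast_pow, Nat.cast_ofNat, ← pow_mul, ← pow_mul, mul_comm]
  have h4 : (4 : ℝ) ^ k = ((2 : ℝ) ^ k) ^ 2 := hpow 4 2 rfl
  have h8 : (8 : ℝ) ^ k = ((2 : ℝ) ^ k) ^ 3 := hpow 8 3 rfl
  have h16 : (16 : ℝ) ^ k = ((2 : ℝ) ^ k) ^ 4 := hpow 16 4 rfl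
  have h32 : (32 : ℝ) ^ k = ((2 : ℝ) ^ k) ^ 5 := hpow 32 5 rfl
  have h64 : (64 : ℝ) ^ k = ((2 : ℝ) ^ k) ^ 6 := hpow 64 6 rfl
  have h128 : (128 : ℝ) ^ k = ((2 : ℝ) ^ k) ^ 7 := hpow 128 7 rfl
  refine ⟨⟨e⟩, ?_, ?_, ?_, ?_, ?_⟩
  · rw [CommonNeighbourhood.cnlSpec_iso e, CommonNeighbourhood.cnlSpec_threeCliqueTypes hq hh,
      ← pow_mul, mul_comm k 2]
    push_cast
    rfl
  · rw [CommonNeighbourhood.cnslSpec_iso e, CommonNeighbourhood.cnslSpec_threeCliqueTypes hq]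
    push_cast
    rfl
  · rw [CommonNeighbourhood.cnlEnergy, CommonNeighbourhood.cnlSpec_iso e,
      CommonNeighbourhood.cnDelta_iso e, ← CommonNeighbourhood.cnlEnergy,
      CommonNeighbourhood.cnlEnergy_threeCliqueTypes hq hh, h8, h16, h32, h64, pow_add, pow_mul',
      pow_succ 4, h4]
    push_cast
    ring
  · rintro rfl
    rw [CommonNeighbourhood.cnslEnergy, CommonNeighbourhood.cnslSpec_iso e,
      CommonNeighbourhood.cnDelta_iso e, ← CommonNeighbourhood.cnslEnergy]
    exact CommonNeighbourhood.cnslEnergy_threeCliqueTypes_four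
  · intro hk3
    rw [CommonNeighbourhood.cnslEnergy, CommonNeighbourhood.cnslSpec_iso e,
      CommonNeighbourhood.cnDelta_iso e, ← CommonNeighbourhood.cnslEnergy,
      CommonNeighbourhood.cnslEnergy_threeCliqueTypes (Nat.pow_le_pow_right two_pos hk3) hh, h8,
      h4, h32, h64, h128, pow_add, pow_add, pow_add, pow_mul', pow_mul']
    push_cast
    ring
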